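/- A line arrangement $\mathcal A=(L_1,\dots,L_n)$ is an ordered $n$-tuple of distinct lines in $\mathbb{CP}^2$, regarded as a point of $((\mathbb{CP}^2)^*)^n$. Its intersection lattice $L(\mathcal A)$ is the set of all intersections of subfamilies of $\{L_1,\dots,L_n\}$ (including $\mathbb{CP}^2$, the empty intersection), ordered by reverse inclusion. For $\mathcal B=(K_1,\dots,K_n)\in((\mathbb{CP}^2)^*)^n$ write $L(\mathcal B)\sim L(\mathcal A)$ if there is an isomorphism of posets $L(\mathcal A)\to L(\mathcal B)$ sending $L_i$ to $K_i$ for every $i$. The moduli space of $\mathcal A$ is $$\mathcal M_{\mathcal A}=\{\mathcal B\in((\mathbb{CP}^2)^*)^n : L(\mathcal B)\sim L(\mathcal A)\}\big/\mathrm{PGL}_3(\mathbb C),$$ with the quotient of the topology induced by the Zariski topology of the multiprojective variety $((\mathbb{CP}^2)^*)^n$. The multiplicity of a point is the number of lines of $\mathcal A$ through it. Proposition. Let $\mathcal A$ be an arrangement of $9$ lines in $\mathbb{CP}^2$. If some point of $\mathbb{CP}^2$ has multiplicity at least $5$ in $\mathcal A$, then the moduli space $\mathcal M_{\mathcal A}$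 is irreducible. -/

import Mathlib

open scoped LinearAlgebra.Projectivization

noncomputable section

namespace LineArrangement

/-- The complex projective plane, as a set of points `[x : y : z]`. -/
abbrev Plane : Type := ℙ ℂ (Fin 3 → ℂ)

/-- The dual projective plane: `[a : b : c]` stands for the line `a x + b y + c z = 0`. -/
abbrev DualPlane : Type := ℙ ℂ (Fin 3 → ℂ)

/-- The set of points of the line with coefficients `ℓ = [a : b : c]`. -/
def line (ℓ : DualPlane) : Set Plane := {p | Projectivization.orthogonal ℓ p}

/-- The product of `n` copies of the dual projective plane, whose points are the ordered `n`-tuples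
of (not necessarily distinct) lines. It is a type of its own because it carries the Zariski
topology of a multiprojective variety, which is not a product topology. -/
def LineTuple (n : ℕ) : Type := Fin n → DualPlane

/-- `f`, a polynomial in the coefficients of `n` lines (the variable `(i, j)` is the `j`-th
coefficient of the `i`-th line), is multihomogeneous of multidegree `d`: for each `i` it is
homogeneous of degree `d i` in the three coefficients of the `i`-th line. -/
def IsMultihomogeneous {n : ℕ} (f : MvPolynomial (Fin n × Fin 3) ℂ) (d : Fin n → ℕ) : Prop :=
  f.IsWeightedHomogeneous (fun p : Fin n × Fin 3 => (Pi.single p.1 1 : Fin n → ℕ)) d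

/-- The set of tuples of lines at which `f` does not vanish. For a multihomogeneous `f` this does
not depend on the coefficient vectors chosen for the lines. -/
def nonvanishing {n : ℕ} (f : MvPolynomial (Fin n × Fin 3) ℂ) : Set (LineTuple n) :=
  {B | MvPolynomial.eval (fun p : Fin n × Fin 3 => (B p.1).rep p.2) f ≠ 0}

/-- The Zariski topology on `n`-tuples of lines: the nonvanishing loci of multihomogeneous
polynomials are a basis (they are stable under finite intersections), so that the closed sets are
the common zero loci of families of multihomogeneous polynomials. -/
instance zariskiTopology (n : ℕ) : TopologicalSpace (LineTuple n) :=
  TopologicalSpace.generateFrom {U | ∃ f d, IsMultihomogeneous f d ∧ U = nonvanishing f}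

/-- An arrangement of `n` lines, with an ordering of its lines: the lines are distinct. -/
def IsArrangement {n : ℕ} (A : LineTuple n) : Prop := Function.Injective A

/-- The multiplicity of a point: the number of lines of the arrangement through it. -/
def multiplicity {n : ℕ} (A : LineTuple n) (P : Plane) : ℕ :=
  Set.ncard {i : Fin n | P ∈ line (A i)}

/-- The intersection lattice: all intersections of subfamilies of the lines (the whole plane is the
empty intersection), partially ordered by inclusion. Ordering by reverse inclusion instead gives
the same isomorphisms. -/
def intersectionLattice {n : ℕ} (A : LineTuple n) : Set (Set Plane) :=
  Set.range fun I : Set (Fin n) => ⋂ i ∈ I, line (A i)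

theorem line_mem_intersectionLattice {n : ℕ} (A : LineTuple n) (i : Fin n) :
    line (A i) ∈ intersectionLattice A :=
  ⟨{i}, by simp⟩

/-- `L(A) ∼ L(B)` for ordered arrangements: there is an isomorphism of intersection lattices that
takes the `i`-th line of `A` to the `i`-th line of `B` for each `i`. -/
def LatticeIsomorphic {n : ℕ} (A B : LineTuple n) : Prop :=
  ∃ φ : intersectionLattice A ≃o intersectionLattice B,
    ∀ i, φ ⟨line (A i), line_mem_intersectionLattice A i⟩ =
      ⟨line (B i), line_mem_intersectionLattice B i⟩

/-- The tuples of lines with the same intersection lattice as `A`, with the subspace topology. -/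
abbrev RealizationSpace {n : ℕ} (A : LineTuple n) : Type :=
  {B : LineTuple n // LatticeIsomorphic A B}

/-- `B` and `C` are in the same orbit of `PGL₃(ℂ)`: one projective transformation of the plane takes
the `i`-th line of `B` to the `i`-th line of `C` for each `i`. -/
def ProjectivelyEquivalent {n : ℕ} (B C : LineTuple n) : Prop :=
  ∃ g : Matrix.ProjGenLinGroup (Fin 3) ℂ, ∀ i, (fun p : Plane => g • p) '' line (B i) = line (C i)

theorem projectivelyEquivalent_equivalence (n : ℕ) :
    Equivalence (ProjectivelyEquivalent (n := n)) where
  refl B := ⟨1, fun i => by simp⟩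
  symm := by
    rintro B C ⟨g, hg⟩
    refine ⟨g⁻¹, fun i => ?_⟩
    rw [← hg i, Set.image_image]
    simp
  trans := by
    rintro B C D ⟨g, hg⟩ ⟨h, hh⟩
    refine ⟨h * g, fun i => ?_⟩
    rw [← hh i, ← hg i, Set.image_image]
    simp [mul_smul]

/-- Projective equivalence on the realization space of `A`. -/
def projectiveSetoid {n : ℕ} (A : LineTuple n) : Setoid (RealizationSpace A) where
  r B C := ProjectivelyEquivalent B.1 C.1
  iseqv :=
    ⟨fun B => (projectivelyEquivalent_equivalence n).refl B.1,
      fun h => (projectivelyEquivalent_equivalence n).symm h,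
      fun h h' => (projectivelyEquivalent_equivalence n).trans h h'⟩

/-- The moduli space of arrangements with the intersection lattice of `A`: the realization space
modulo `PGL₃(ℂ)`. -/
def ModuliSpace {n : ℕ} (A : LineTuple n) : Type := Quotient (projectiveSetoid A)

/-- The moduli space has the quotient topology of the Zariski topology. -/
instance moduliTopology {n : ℕ} (A : LineTuple n) : TopologicalSpace (ModuliSpace A) :=
  inferInstanceAs (TopologicalSpace (Quotient (projectiveSetoid A)))

end LineArrangement

end

/-!
Dualize: the lines of an arrangement are points of the dual plane, given by vectors `x i` in `ℂ³`,
and three lines are concurrent exactly when the bracket (determinant) of their vectors vanishes.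
For distinct lines the intersection lattice records which brackets vanish and nothing else
(`latticeIsomorphic_iff`).

The moduli space is irreducible as soon as any two realizations `B`, `C`, after a projective
transformation and a rescaling of the coefficient vectors, are joined by a straight line
`t ↦ (1 - t) x + t y` on which the brackets that vanish for `A` vanish identically
(`irreducibleSpace_moduliSpace`). Indeed all other brackets are nonzero polynomials in `t`, and so
is the pullback of any multihomogeneous polynomial that does not vanish at `B` (at `t = 0`) or at
`C` (at `t = 1`). Hence for all but finitely many `t` the point on the line is a realization that
lies in prescribed neighbourhoods of `B` and of `C`.

To find this line, let `T` be the set of lines that miss the multiple point; there are at most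
four. In the dual plane the lines through the multiple point are points of one line, which is
taken as the line at infinity, and `T` becomes a set of at most four affine points. Affine
transformations can match `T` in `B` with `T` in `C` except for one point, or put both on one
common affine line (`exists_matrix_of_normalized`). Move the points of `T` linearly from `B` to
`C`. A point at infinity on the join of two points `k`, `l` of `T` follows the difference vector
`x k - x l`, which also moves linearly; the other points at infinity are moved linearly without
any constraint. A bracket that has to vanish then involves only motions along a common direction,
so that it is an affine function of `t` which is zero at `t = 0` and `t = 1`
(`bracket_interpolate_eq_zero`), or it is a bracket of three vectors in a fixed plane
(`exists_interpolation_of_normalized`).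
-/

namespace LineArrangement

open Filter
open scoped Matrix

variable {ι : Type*} {n : ℕ}

/-! ### Brackets of vectors in `ℂ³` -/

/-- The bracket `[u, v, w]`, that is the determinant of the matrix with rows `u`, `v`, `w`. -/
def bracket (u v w : Fin 3 → ℂ) : ℂ := u ⬝ᵥ v ⨯₃ w

theorem bracket_eq (u v w : Fin 3 → ℂ) :
    bracket u v w = u 0 * (v 1 * w 2 - v 2 * w 1) + u 1 * (v 2 * w 0 - v 0 * w 2) +
      u 2 * (v 0 * w 1 - v 1 * w 0) := by
  simp [bracket, cross_apply, dotProduct, Fin.sum_univ_three]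

theorem dot_eq (u v : Fin 3 → ℂ) : u ⬝ᵥ v = u 0 * v 0 + u 1 * v 1 + u 2 * v 2 := by
  simp [dotProduct, Fin.sum_univ_three]

theorem bracket_rotate (u v w : Fin 3 → ℂ) : bracket u v w = bracket v w u := by
  simp only [bracket_eq]; ring

theorem bracket_self_left (u v : Fin 3 → ℂ) : bracket u u v = 0 := by
  simp only [bracket_eq]; ring

theorem bracket_smul (a b c : ℂ) (u v w : Fin 3 → ℂ) :
    bracket (a • u) (b • v) (c • w) = a * b * c * bracket u v w := by
  simp only [bracket_eq, Pi.smul_apply, smul_eq_mul]; ring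

theorem bracket_mulVec (M : Matrix (Fin 3) (Fin 3) ℂ) (u v w : Fin 3 → ℂ) :
    bracket (M *ᵥ u) (M *ᵥ v) (M *ᵥ w) = M.det * bracket u v w := by
  simp only [bracket_eq, Matrix.det_fin_three, Matrix.mulVec, dot_eq]; ring

theorem exists_dot_eq_one {p : Fin 3 → ℂ} (hp : p ≠ 0) : ∃ v : Fin 3 → ℂ, v ⬝ᵥ p = 1 := by
  obtain ⟨i, hi⟩ := Function.ne_iff.1 hp
  exact ⟨Pi.single i (p i)⁻¹, by rw [single_dotProduct]; exact inv_mul_cancel₀ hi⟩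

/-- Three vectors in a common plane `p⊥` have bracket zero. -/
theorem bracket_eq_zero_of_dot {p u v w : Fin 3 → ℂ} (hp : p ≠ 0) (hu : u ⬝ᵥ p = 0)
    (hv : v ⬝ᵥ p = 0) (hw : w ⬝ᵥ p = 0) : bracket u v w = 0 := by
  by_contra h
  refine hp (funext fun i => ?_)
  refine (mul_eq_zero_iff_left h).1 ?_
  rw [dot_eq] at hu hv hw
  rw [bracket_eq]
  fin_cases i <;> simp only [Fin.zero_eta, Fin.mk_one, Fin.reduceFinMk]
  · linear_combination (v 1 * w 2 - v 2 * w 1) * hu + (w 1 * u 2 - w 2 * u 1) * hv +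
      (u 1 * v 2 - u 2 * v 1) * hw
  · linear_combination (v 2 * w 0 - v 0 * w 2) * hu + (w 2 * u 0 - w 0 * u 2) * hv +
      (u 2 * v 0 - u 0 * v 2) * hw
  · linear_combination (v 0 * w 1 - v 1 * w 0) * hu + (w 0 * u 1 - w 1 * u 0) * hv +
      (u 0 * v 1 - u 1 * v 0) * hw

/-- If `u`, `v` are independent vectors of the plane `p⊥`, a vector `w` with `[u, v, w] = 0` lies in
this plane. -/
theorem dot_eq_zero_of_bracket {p u v w : Fin 3 → ℂ} (huv : u ⨯₃ v ≠ 0)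
    (h : bracket u v w = 0) (hu : u ⬝ᵥ p = 0) (hv : v ⬝ᵥ p = 0) : w ⬝ᵥ p = 0 := by
  by_contra hw
  refine huv (funext fun i => ?_)
  refine (mul_eq_zero_iff_left hw).1 ?_
  rw [bracket_eq] at h
  rw [dot_eq] at hu hv ⊢
  rw [cross_apply]
  fin_cases i <;> simp only [Fin.zero_eta, Fin.mk_one, Fin.reduceFinMk, Matrix.cons_val]
  · linear_combination p 0 * h + (w 1 * v 2 - w 2 * v 1) * hu + (w 2 * u 1 - w 1 * u 2) * hv
  · linear_combination p 1 * h + (w 2 * v 0 - w 0 * v 2) * hu + (w 0 * u 2 - w 2 * u 0) * hv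
  · linear_combination p 2 * h + (w 0 * v 1 - w 1 * v 0) * hu + (w 1 * u 0 - w 0 * u 1) * hv

theorem cross_smul_smul (a b : ℂ) (u v : Fin 3 → ℂ) :
    (a • u) ⨯₃ (b • v) = (a * b) • (u ⨯₃ v) := by
  simp [smul_smul, mul_comm]

/-- In the chart `p = 1`, the point at infinity `u` of the affine line through `v` and `w` is the
direction `v - w`. -/
theorem exists_smul_sub_eq {p u v w : Fin 3 → ℂ} (hvw : v ⨯₃ w ≠ 0) (hu0 : u ≠ 0)
    (h : bracket u v w = 0) (hu : u ⬝ᵥ p = 0) (hv : v ⬝ᵥ p = 1) (hw : w ⬝ᵥ p = 1) :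
    ∃ a : ℂ, a ≠ 0 ∧ v - w = a • u := by
  have h2 : (v - w) ⨯₃ u = 0 := by
    rw [bracket_eq] at h
    rw [dot_eq] at hu hv hw
    rw [cross_apply]
    funext i
    fin_cases i <;>
      simp only [Fin.zero_eta, Fin.mk_one, Fin.reduceFinMk, Matrix.cons_val, Pi.sub_apply,
        Pi.zero_apply]
    · linear_combination -((v 1 - w 1) * u 2 - (v 2 - w 2) * u 1) * hv - p 0 * h +
        (v 1 * u 2 - v 2 * u 1) * (hv - hw) + (v 1 * w 2 - v 2 * w 1) * hu
    · linear_combination -((v 2 - w 2) * u 0 - (v 0 - w 0) * u 2) * hv - p 1 * h +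
        (v 2 * u 0 - v 0 * u 2) * (hv - hw) + (v 2 * w 0 - v 0 * w 2) * hu
    · linear_combination -((v 0 - w 0) * u 1 - (v 1 - w 1) * u 0) * hv - p 2 * h +
        (v 0 * u 1 - v 1 * u 0) * (hv - hw) + (v 0 * w 1 - v 1 * w 0) * hu
  have hne : v - w ≠ 0 := by
    intro h0
    rw [sub_eq_zero] at h0
    exact hvw (by rw [h0, cross_self])
  have := (Projectivization.mk_eq_mk_iff_crossProduct_eq_zero hne hu0).2 h2
  obtain ⟨a, ha⟩ := (Projectivization.mk_eq_mk_iff' _ _ _ _ _).1 this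
  refine ⟨a, ?_, ha.symm⟩
  rintro rfl
  exact hne (by simpa using ha.symm)

/-- A linear map with prescribed values on a basis. -/
theorem exists_matrix {e₁ e₂ e₃ f₁ f₂ f₃ : Fin 3 → ℂ} (he : bracket e₁ e₂ e₃ ≠ 0)
    (hf : bracket f₁ f₂ f₃ ≠ 0) : ∃ M : Matrix (Fin 3) (Fin 3) ℂ, M.det ≠ 0 ∧
      M *ᵥ e₁ = f₁ ∧ M *ᵥ e₂ = f₂ ∧ M *ᵥ e₃ = f₃ := by
  rw [bracket, triple_product_eq_det] at he hf
  obtain ⟨E, hE⟩ : ∃ E : Matrix (Fin 3) (Fin 3) ℂ, E = (Matrix.of ![e₁, e₂, e₃])ᵀ := ⟨_, rfl⟩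
  obtain ⟨F, hF⟩ : ∃ F : Matrix (Fin 3) (Fin 3) ℂ, F = (Matrix.of ![f₁, f₂, f₃])ᵀ := ⟨_, rfl⟩
  replace he : E.det ≠ 0 := by rw [hE, Matrix.det_transpose]; exact he
  replace hf : F.det ≠ 0 := by rw [hF, Matrix.det_transpose]; exact hf
  have key : ∀ l, (F * E⁻¹) *ᵥ (E.col l) = F.col l := by
    intro l
    rw [← Matrix.mulVec_single_one, Matrix.mulVec_mulVec, Matrix.mul_assoc,
      Matrix.nonsing_inv_mul _ (isUnit_iff_ne_zero.2 he), Matrix.mul_one,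
      Matrix.mulVec_single_one]
  refine ⟨F * E⁻¹, ?_, by simpa [hE, hF] using! key 0, by simpa [hE, hF] using! key 1,
    by simpa [hE, hF] using! key 2⟩
  rw [Matrix.det_mul, Matrix.det_nonsing_inv, Ring.inverse_eq_inv']
  exact mul_ne_zero hf (inv_ne_zero he)

/-- Linear functionals on `ℂ³` can be compared on a basis. -/
theorem dot_mulVec_of_basis {e₁ e₂ e₃ p q : Fin 3 → ℂ} {M : Matrix (Fin 3) (Fin 3) ℂ}
    (he : bracket e₁ e₂ e₃ ≠ 0) (h₁ : (M *ᵥ e₁) ⬝ᵥ q = e₁ ⬝ᵥ p) (h₂ : (M *ᵥ e₂) ⬝ᵥ q = e₂ ⬝ᵥ p)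
    (h₃ : (M *ᵥ e₃) ⬝ᵥ q = e₃ ⬝ᵥ p) (v : Fin 3 → ℂ) : (M *ᵥ v) ⬝ᵥ q = v ⬝ᵥ p := by
  have aux : ∀ v, (M *ᵥ v) ⬝ᵥ q = v ⬝ᵥ p ↔ v ⬝ᵥ (q ᵥ* M - p) = 0 := by
    intro v
    rw [dotProduct_sub, sub_eq_zero, dotProduct_comm (M *ᵥ v), Matrix.dotProduct_mulVec,
      dotProduct_comm v (q ᵥ* M)]
  have : q ᵥ* M - p = 0 := by
    by_contra h0
    exact he (bracket_eq_zero_of_dot h0 ((aux _).1 h₁) ((aux _).1 h₂) ((aux _).1 h₃))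
  rw [aux, this, dotProduct_zero]

/-! ### Linear motions -/

/-- The linear motion from `u` at time `0` to `v` at time `1`, with complex time `t`. -/
def interpolate (t : ℂ) (u v : Fin 3 → ℂ) : Fin 3 → ℂ := (1 - t) • u + t • v

theorem interpolate_apply (t : ℂ) (u v : Fin 3 → ℂ) (i : Fin 3) :
    interpolate t u v i = (1 - t) * u i + t * v i := rfl

theorem interpolate_dot (t : ℂ) (u v p : Fin 3 → ℂ) :
    interpolate t u v ⬝ᵥ p = (1 - t) * (u ⬝ᵥ p) + t * (v ⬝ᵥ p) := by
  simp [interpolate, add_dotProduct, smul_dotProduct]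

theorem interpolate_zero (u v : Fin 3 → ℂ) : interpolate 0 u v = u := by simp [interpolate]

theorem interpolate_one (u v : Fin 3 → ℂ) : interpolate 1 u v = v := by simp [interpolate]

/-- As a function of time, the bracket of three points moving linearly along a common direction `e`
is affine: the terms of higher order contain `e` twice. -/
theorem bracket_interpolate_eq_zero {u v w u' v' w' e : Fin 3 → ℂ} (hu : ∃ a : ℂ, u' = u + a • e)
    (hv : ∃ a : ℂ, v' = v + a • e) (hw : ∃ a : ℂ, w' = w + a • e) (h : bracket u v w = 0)
    (h' : bracket u' v' w' = 0) (t : ℂ) :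
    bracket (interpolate t u u') (interpolate t v v') (interpolate t w w') = 0 := by
  obtain ⟨a, rfl⟩ := hu
  obtain ⟨b, rfl⟩ := hv
  obtain ⟨c, rfl⟩ := hw
  rw [bracket_eq] at h h' ⊢
  simp only [interpolate_apply, Pi.add_apply, Pi.smul_apply, smul_eq_mul] at h h' ⊢
  linear_combination (1 - t) * h + t * h'

/-! ### Configurations with the same matroid -/

/-- `x` and `y` are families of nonzero, pairwise nonproportional vectors with the same vanishing
brackets; in other words, they represent the same simple matroid of rank at most three. -/
structure SameMatroid (x y : ι → Fin 3 → ℂ) : Prop where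
  ne_zero_left : ∀ i, x i ≠ 0
  ne_zero_right : ∀ i, y i ≠ 0
  cross_left : ∀ i j, i ≠ j → x i ⨯₃ x j ≠ 0
  cross_right : ∀ i j, i ≠ j → y i ⨯₃ y j ≠ 0
  bracket_iff : ∀ i j k, bracket (x i) (x j) (x k) = 0 ↔ bracket (y i) (y j) (y k) = 0

theorem SameMatroid.symm_trans {a x y : ι → Fin 3 → ℂ} (hx : SameMatroid a x)
    (hy : SameMatroid a y) : SameMatroid x y where
  ne_zero_left := hx.ne_zero_right
  ne_zero_right := hy.ne_zero_right
  cross_left := hx.cross_right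
  cross_right := hy.cross_right
  bracket_iff i j k := (hx.bracket_iff i j k).symm.trans (hy.bracket_iff i j k)

theorem SameMatroid.symm {x y : ι → Fin 3 → ℂ} (h : SameMatroid x y) :
    SameMatroid y x where
  ne_zero_left := h.ne_zero_right
  ne_zero_right := h.ne_zero_left
  cross_left := h.cross_right
  cross_right := h.cross_left
  bracket_iff i j k := (h.bracket_iff i j k).symm

theorem SameMatroid.smul {x y : ι → Fin 3 → ℂ} (h : SameMatroid x y) {a b : ι → ℂ}
    (ha : ∀ i, a i ≠ 0) (hb : ∀ i, b i ≠ 0) :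
    SameMatroid (fun i => a i • x i) (fun i => b i • y i) where
  ne_zero_left i := smul_ne_zero (ha i) (h.ne_zero_left i)
  ne_zero_right i := smul_ne_zero (hb i) (h.ne_zero_right i)
  cross_left i j hij := by
    rw [cross_smul_smul]
    exact smul_ne_zero (mul_ne_zero (ha i) (ha j)) (h.cross_left i j hij)
  cross_right i j hij := by
    rw [cross_smul_smul]
    exact smul_ne_zero (mul_ne_zero (hb i) (hb j)) (h.cross_right i j hij)
  bracket_iff i j k := by
    rw [bracket_smul, bracket_smul, mul_eq_zero_iff_left, mul_eq_zero_iff_left, h.bracket_iff]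
    · exact mul_ne_zero (mul_ne_zero (hb i) (hb j)) (hb k)
    · exact mul_ne_zero (mul_ne_zero (ha i) (ha j)) (ha k)

theorem mulVec_injective_of_det_ne_zero {M : Matrix (Fin 3) (Fin 3) ℂ} (hM : M.det ≠ 0) :
    Function.Injective (M *ᵥ ·) :=
  Matrix.mulVec_injective_of_isUnit ((Matrix.isUnit_iff_isUnit_det M).2 (isUnit_iff_ne_zero.2 hM))

theorem SameMatroid.mulVec {x y : ι → Fin 3 → ℂ} (h : SameMatroid x y)
    {M : Matrix (Fin 3) (Fin 3) ℂ} (hM : M.det ≠ 0) : SameMatroid (fun i => M *ᵥ x i) y where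
  ne_zero_left i h0 := h.ne_zero_left i (mulVec_injective_of_det_ne_zero hM (by simpa using h0))
  ne_zero_right := h.ne_zero_right
  cross_left i j hij h0 := by
    rw [← not_ne_iff, crossProduct_ne_zero_iff_linearIndependent] at h0
    have := (crossProduct_ne_zero_iff_linearIndependent.1 (h.cross_left i j hij)).map' M.mulVecLin
      (LinearMap.ker_eq_bot.2 (mulVec_injective_of_det_ne_zero hM))
    have e : M.mulVecLin ∘ ![x i, x j] = ![M *ᵥ x i, M *ᵥ x j] := by
      funext k
      fin_cases k <;> rfl
    rw [e] at this
    exact h0 this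
  cross_right := h.cross_right
  bracket_iff i j k := by
    rw [bracket_mulVec, mul_eq_zero_iff_left hM, h.bracket_iff]

/-! ### Linear motions of a pencil and at most four further vectors -/

/-- The vectors with index in `T` are scaled into the affine chart `p = 1`, and all others lie on the
line at infinity `p = 0`. -/
def IsNormalized (T : Finset ι) (x : ι → Fin 3 → ℂ) (p : Fin 3 → ℂ) : Prop :=
  (∀ i ∉ T, x i ⬝ᵥ p = 0) ∧ ∀ i ∈ T, x i ⬝ᵥ p = 1

/-- Let two configurations be normalized with respect to the same `p`, and suppose that the points
with index in `T` either all move along one direction `e` or all stay in one plane `w⊥`. Then the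
vectors can be rescaled such that the linear motion from `x` to `y` keeps all vanishing brackets. -/
theorem exists_interpolation_of_normalized {T : Finset ι} {x y : ι → Fin 3 → ℂ} {p : Fin 3 → ℂ}
    (hp : p ≠ 0) (hxy : SameMatroid x y) (hx : IsNormalized T x p) (hy : IsNormalized T y p)
    (h : (∃ e : Fin 3 → ℂ, ∀ k ∈ T, ∃ r : ℂ, y k = x k + r • e) ∨
      ∃ w, w ≠ 0 ∧ ∀ k ∈ T, x k ⬝ᵥ w = 0 ∧ y k ⬝ᵥ w = 0) :
    ∃ a b : ι → ℂ, (∀ i, a i ≠ 0) ∧ (∀ i, b i ≠ 0) ∧ ∀ i j k,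
      bracket (x i) (x j) (x k) = 0 → ∀ t, bracket (interpolate t (a i • x i) (b i • y i))
        (interpolate t (a j • x j) (b j • y j)) (interpolate t (a k • x k) (b k • y k)) = 0 := by
  have hab : ∀ i, ∃ a b : ℂ, a ≠ 0 ∧ b ≠ 0 ∧ (i ∈ T → a = 1 ∧ b = 1) ∧
      (i ∉ T → ∀ k ∈ T, ∀ l ∈ T, k ≠ l → bracket (x i) (x k) (x l) = 0 →
        ∃ k' ∈ T, ∃ l' ∈ T, a • x i = x k' - x l' ∧ b • y i = y k' - y l') := by
    intro i
    -- A point at infinity on the join of `k` and `l` is rescaled to the difference vector. It may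
    -- lie on several such joins; any of them will do.
    by_cases hi : i ∉ T ∧ ∃ k ∈ T, ∃ l ∈ T, k ≠ l ∧ bracket (x i) (x k) (x l) = 0
    · obtain ⟨hi, k, hk, l, hl, hkl, h0⟩ := hi
      obtain ⟨a, ha, ha'⟩ := exists_smul_sub_eq (hxy.cross_left k l hkl) (hxy.ne_zero_left i) h0
        (hx.1 i hi) (hx.2 k hk) (hx.2 l hl)
      obtain ⟨b, hb, hb'⟩ := exists_smul_sub_eq (hxy.cross_right k l hkl) (hxy.ne_zero_right i)
        ((hxy.bracket_iff _ _ _).1 h0) (hy.1 i hi) (hy.2 k hk) (hy.2 l hl)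
      exact ⟨a, b, ha, hb, fun h => absurd h hi,
        fun _ _ _ _ _ _ _ => ⟨k, hk, l, hl, ha'.symm, hb'.symm⟩⟩
    · refine ⟨1, 1, one_ne_zero, one_ne_zero, fun _ => ⟨rfl, rfl⟩, fun hiT k hk l hl hkl h0 => ?_⟩
      exact absurd ⟨hiT, k, hk, l, hl, hkl, h0⟩ hi
  choose a b ha hb hT hS using hab
  refine ⟨a, b, ha, hb, ?_⟩
  have segT : ∀ {i}, i ∈ T → ∀ t,
      interpolate t (a i • x i) (b i • y i) = interpolate t (x i) (y i) := by
    intro i hi t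
    rw [(hT i hi).1, (hT i hi).2, one_smul, one_smul]
  have segS : ∀ {i}, i ∉ T → ∀ t, interpolate t (a i • x i) (b i • y i) ⬝ᵥ p = 0 := by
    intro i hi t
    rw [interpolate_dot, smul_dotProduct, smul_dotProduct, hx.1 i hi, hy.1 i hi]; simp
  -- Two distinct points at infinity span the line at infinity, which misses the points of `T`.
  have caseTwo : ∀ i j k, i ∉ T → j ∉ T → k ∈ T → bracket (x i) (x j) (x k) = 0 → ∀ t,
      bracket (interpolate t (a i • x i) (b i • y i))
        (interpolate t (a j • x j) (b j • y j)) (interpolate t (a k • x k) (b k • y k)) = 0 := by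
    intro i j k hi hj hk h0 t
    obtain rfl : i = j := by
      by_contra hij
      have := dot_eq_zero_of_bracket (hxy.cross_left i j hij) h0 (hx.1 i hi) (hx.1 j hj)
      rw [hx.2 k hk] at this
      exact one_ne_zero this
    rw [bracket_self_left]
  -- A point at infinity on the join of two points of `T` moves like a difference of points of `T`.
  have caseOne : ∀ i j k, i ∉ T → j ∈ T → k ∈ T → bracket (x i) (x j) (x k) = 0 → ∀ t,
      bracket (interpolate t (a i • x i) (b i • y i))
        (interpolate t (a j • x j) (b j • y j)) (interpolate t (a k • x k) (b k • y k)) = 0 := by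
    intro i j k hi hj hk h0 t
    by_cases hjk : j = k
    · rw [hjk, bracket_rotate, bracket_self_left]
    obtain ⟨m, hm, n, hn, e₁, e₂⟩ := hS i hi j hj k hk hjk h0
    rw [segT hj, segT hk, e₁, e₂]
    rcases h with ⟨e, he⟩ | ⟨w, hw, hTw⟩
    · refine bracket_interpolate_eq_zero ?_ (he j hj) (he k hk) ?_ ?_ t
      · obtain ⟨r, hr⟩ := he m hm
        obtain ⟨s, hs⟩ := he n hn
        exact ⟨r - s, by rw [hr, hs, sub_smul]; abel⟩
      · rw [← e₁, ← one_smul ℂ (x j), ← one_smul ℂ (x k), bracket_smul, h0, mul_zero]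
      · rw [← e₂, ← one_smul ℂ (y j), ← one_smul ℂ (y k), bracket_smul,
          (hxy.bracket_iff _ _ _).1 h0, mul_zero]
    · apply bracket_eq_zero_of_dot hw <;>
        simp [interpolate_dot, sub_dotProduct, hTw m hm, hTw n hn, hTw j hj, hTw k hk]
  intro i j k h0 t
  by_cases hi : i ∈ T <;> by_cases hj : j ∈ T <;> by_cases hk : k ∈ T
  · rw [segT hi, segT hj, segT hk]
    rcases h with ⟨e, he⟩ | ⟨w, hw, hTw⟩
    · exact bracket_interpolate_eq_zero (he i hi) (he j hj) (he k hk) h0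
        ((hxy.bracket_iff _ _ _).1 h0) t
    · apply bracket_eq_zero_of_dot hw <;>
        simp [interpolate_dot, hTw i hi, hTw j hj, hTw k hk]
  · rw [← bracket_rotate] at h0 ⊢
    exact caseOne k i j hk hi hj h0 t
  · rw [bracket_rotate] at h0 ⊢
    exact caseOne j k i hj hk hi h0 t
  · rw [bracket_rotate] at h0 ⊢
    exact caseTwo j k i hj hk hi h0 t
  · exact caseOne i j k hi hj hk h0 t
  · rw [← bracket_rotate] at h0 ⊢
    exact caseTwo k i j hk hi hj h0 t
  · exact caseTwo i j k hi hj hk h0 t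
  · exact bracket_eq_zero_of_dot hp (segS hi t) (segS hj t) (segS hk t)

/-- The join of two distinct points, one of which is not at infinity, misses some point at
infinity of the configuration, if there are two such points. -/
theorem exists_bracket_ne_zero_of_notMem {T : Finset ι} {x : ι → Fin 3 → ℂ} {p : Fin 3 → ℂ}
    (hc : ∀ i j, i ≠ j → x i ⨯₃ x j ≠ 0) (hx : IsNormalized T x p) {i j k l : ι} (hi : i ∉ T)
    (hj : j ∉ T) (hij : i ≠ j) (hk : k ∈ T) (hkl : k ≠ l) :
    ∃ s ∉ T, bracket (x s) (x k) (x l) ≠ 0 := by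
  by_contra! h
  have h0 : bracket (x i) (x j) (x k) = 0 :=
    bracket_eq_zero_of_dot (hc k l hkl) (h i hi) (h j hj) (dot_self_cross _ _)
  have := dot_eq_zero_of_bracket (hc i j hij) h0 (hx.1 i hi) (hx.1 j hj)
  rw [hx.2 k hk] at this
  exact one_ne_zero this

/-- At most four affine points can be matched with their counterparts by an affine transformation,
up to one point or up to a motion inside one line: use three noncollinear points as a frame if there
are any; otherwise two distinct points and a point at infinity; otherwise the only point (an
arbitrary one if `T` is empty) and two points at infinity. -/
theorem exists_matrix_of_normalized [DecidableEq ι] {T : Finset ι} (hT : T.card ≤ 4)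
    {x y : ι → Fin 3 → ℂ} {p q : Fin 3 → ℂ} (hp : p ≠ 0) (hq : q ≠ 0) (hxy : SameMatroid x y)
    (hx : IsNormalized T x p) (hy : IsNormalized T y q) {i j : ι} (hi : i ∉ T) (hj : j ∉ T)
    (hij : i ≠ j) :
    ∃ M : Matrix (Fin 3) (Fin 3) ℂ, M.det ≠ 0 ∧ (∀ v, (M *ᵥ v) ⬝ᵥ q = v ⬝ᵥ p) ∧
      ((∃ e : Fin 3 → ℂ, ∀ k ∈ T, ∃ r : ℂ, y k = M *ᵥ x k + r • e) ∨
        ∃ w, w ≠ 0 ∧ ∀ k ∈ T, (M *ᵥ x k) ⬝ᵥ w = 0 ∧ y k ⬝ᵥ w = 0) := by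
  by_cases h3 : ∃ k ∈ T, ∃ l ∈ T, ∃ m ∈ T, bracket (x k) (x l) (x m) ≠ 0
  · obtain ⟨k, hk, l, hl, m, hm, h0⟩ := h3
    obtain ⟨M, hM, hMk, hMl, hMm⟩ :=
      exists_matrix h0 (fun h => h0 ((hxy.bracket_iff _ _ _).2 h))
    refine ⟨M, hM, dot_mulVec_of_basis h0 ?_ ?_ ?_, Or.inl ?_⟩
    · rw [hMk, hx.2 k hk, hy.2 k hk]
    · rw [hMl, hx.2 l hl, hy.2 l hl]
    · rw [hMm, hx.2 m hm, hy.2 m hm]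
    have hkl : k ≠ l := fun h => h0 (by rw [h, bracket_self_left])
    have hlm : l ≠ m := fun h => h0 (by rw [h, bracket_rotate, bracket_self_left])
    have hkm : k ≠ m := fun h => h0 (by rw [h, ← bracket_rotate, bracket_self_left])
    have hsub : ({k, l, m} : Finset ι) ⊆ T := by
      intro a; simp only [Finset.mem_insert, Finset.mem_singleton]; rintro (rfl | rfl | rfl) <;>
        assumption
    -- At most one point `d` is left outside the frame, and its displacement is the direction.
    have hcard : (T \ {k, l, m}).card ≤ 1 := by
      rw [Finset.card_sdiff_of_subset hsub, Finset.card_eq_three.2 ⟨k, l, m, hkl, hkm, hlm, rfl⟩]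
      omega
    have : Nonempty ι := ⟨i⟩
    obtain ⟨d, hd⟩ := Finset.card_le_one_iff_subset_singleton.1 hcard
    refine ⟨y d - M *ᵥ x d, fun n hn => ?_⟩
    by_cases hn3 : n ∈ ({k, l, m} : Finset ι)
    · refine ⟨0, ?_⟩
      rw [zero_smul, add_zero]
      simp only [Finset.mem_insert, Finset.mem_singleton] at hn3
      rcases hn3 with rfl | rfl | rfl
      exacts [hMk.symm, hMl.symm, hMm.symm]
    · obtain rfl := Finset.mem_singleton.1 (hd (Finset.mem_sdiff.2 ⟨hn, hn3⟩))
      exact ⟨1, by rw [one_smul]; abel⟩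
  push Not at h3
  by_cases h2 : ∃ k ∈ T, ∃ l ∈ T, k ≠ l
  · obtain ⟨k, hk, l, hl, hkl⟩ := h2
    obtain ⟨s, hs, h0⟩ := exists_bracket_ne_zero_of_notMem hxy.cross_left hx hi hj hij hk hkl
    obtain ⟨M, hM, hMs, hMk, hMl⟩ :=
      exists_matrix h0 (fun h => h0 ((hxy.bracket_iff _ _ _).2 h))
    refine ⟨M, hM, dot_mulVec_of_basis h0 ?_ ?_ ?_,
      Or.inr ⟨y k ⨯₃ y l, hxy.cross_right k l hkl, fun n hn => ⟨?_, ?_⟩⟩⟩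
    · rw [hMs, hx.1 s hs, hy.1 s hs]
    · rw [hMk, hx.2 k hk, hy.2 k hk]
    · rw [hMl, hx.2 l hl, hy.2 l hl]
    · have := bracket_mulVec M (x n) (x k) (x l)
      rw [h3 n hn k hk l hl, mul_zero, hMk, hMl] at this
      exact this
    · exact (hxy.bracket_iff _ _ _).1 (h3 n hn k hk l hl)
  push Not at h2
  have h1 : ∃ v w : Fin 3 → ℂ, v ⬝ᵥ p = 1 ∧ w ⬝ᵥ q = 1 ∧ ∀ k ∈ T, x k = v ∧ y k = w := by
    rcases T.eq_empty_or_nonempty with rfl | ⟨k, hk⟩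
    · obtain ⟨v, hv⟩ := exists_dot_eq_one hp
      obtain ⟨w, hw⟩ := exists_dot_eq_one hq
      exact ⟨v, w, hv, hw, by simp⟩
    · exact ⟨x k, y k, hx.2 k hk, hy.2 k hk, fun l hl => by rw [h2 l hl k hk]; exact ⟨rfl, rfl⟩⟩
  obtain ⟨v, w, hv, hw, hvw⟩ := h1
  have hb : bracket (x i) (x j) v ≠ 0 := fun h => by
    have := dot_eq_zero_of_bracket (hxy.cross_left i j hij) h (hx.1 i hi) (hx.1 j hj)
    rw [hv] at this
    exact one_ne_zero this
  have hc : bracket (y i) (y j) w ≠ 0 := fun h => by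
    have := dot_eq_zero_of_bracket (hxy.cross_right i j hij) h (hy.1 i hi) (hy.1 j hj)
    rw [hw] at this
    exact one_ne_zero this
  obtain ⟨M, hM, hMi, hMj, hMv⟩ := exists_matrix hb hc
  refine ⟨M, hM, dot_mulVec_of_basis hb ?_ ?_ ?_, Or.inl ⟨0, fun k hk => ⟨0, ?_⟩⟩⟩
  · rw [hMi, hx.1 i hi, hy.1 i hi]
  · rw [hMj, hx.1 j hj, hy.1 j hj]
  · rw [hMv, hv, hw]
  · rw [(hvw k hk).1, (hvw k hk).2, hMv]; simp

/-- The version of `exists_interpolation_of_normalized` without normalization: two configurations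
with the same matroid, in which all but at most four vectors lie in one plane, are joined by a linear
motion that keeps all vanishing brackets, after a linear transformation and a rescaling. -/
theorem exists_interpolation_of_card_le_four [DecidableEq ι] {T : Finset ι} (hT : T.card ≤ 4)
    {x y : ι → Fin 3 → ℂ} {p q : Fin 3 → ℂ} (hp : p ≠ 0) (hq : q ≠ 0) (hxy : SameMatroid x y)
    (hx : ∀ i, x i ⬝ᵥ p = 0 ↔ i ∉ T) (hy : ∀ i, y i ⬝ᵥ q = 0 ↔ i ∉ T) {i j : ι} (hi : i ∉ T)
    (hj : j ∉ T) (hij : i ≠ j) :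
    ∃ M : Matrix (Fin 3) (Fin 3) ℂ, M.det ≠ 0 ∧ ∃ a b : ι → ℂ, (∀ i, a i ≠ 0) ∧ (∀ i, b i ≠ 0) ∧
      ∀ i j k, bracket (x i) (x j) (x k) = 0 → ∀ t,
        bracket (interpolate t (a i • M *ᵥ x i) (b i • y i))
          (interpolate t (a j • M *ᵥ x j) (b j • y j))
          (interpolate t (a k • M *ᵥ x k) (b k • y k)) = 0 := by
  have scale : ∀ {x : ι → Fin 3 → ℂ} {p : Fin 3 → ℂ}, (∀ i, x i ⬝ᵥ p = 0 ↔ i ∉ T) →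
      ∃ a : ι → ℂ, (∀ i, a i ≠ 0) ∧ IsNormalized T (fun i => a i • x i) p := by
    intro x p hx
    refine ⟨fun i => if i ∈ T then (x i ⬝ᵥ p)⁻¹ else 1, fun i => ?_, fun i hi => ?_, fun i hi => ?_⟩
    · dsimp only
      split_ifs with hi
      · exact inv_ne_zero (fun h => (hx i).1 h hi)
      · exact one_ne_zero
    · simp [hi, (hx i).2 hi]
    · simp only [hi, if_true, smul_dotProduct, smul_eq_mul]
      exact inv_mul_cancel₀ (fun h => (hx i).1 h hi)
  obtain ⟨a, ha, hax⟩ := scale hx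
  obtain ⟨b, hb, hby⟩ := scale hy
  have hab := hxy.smul ha hb
  obtain ⟨M, hM, hpq, h⟩ := exists_matrix_of_normalized hT hp hq hab hax hby hi hj hij
  obtain ⟨a', b', ha', hb', H⟩ := exists_interpolation_of_normalized
    (x := fun i => M *ᵥ (a i • x i)) hq (hab.mulVec hM)
    ⟨fun i hi => by rw [hpq, hax.1 i hi], fun i hi => by rw [hpq, hax.2 i hi]⟩ hby h
  refine ⟨M, hM, fun i => a' i * a i, fun i => b' i * b i, fun i => mul_ne_zero (ha' i) (ha i),
    fun i => mul_ne_zero (hb' i) (hb i), fun i j k h0 t => ?_⟩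
  simpa only [Matrix.mulVec_smul, smul_smul] using! H i j k
    (by rw [bracket_mulVec, bracket_smul, h0, mul_zero, mul_zero]) t

/-! ### Intersection lattices and brackets -/

/-- `x` is a choice of coefficient vectors for the lines of `B`. -/
def Represents (B : LineTuple n) (x : Fin n → Fin 3 → ℂ) : Prop :=
  ∀ i, ∃ h : x i ≠ 0, B i = Projectivization.mk ℂ (x i) h

theorem represents_rep (B : LineTuple n) : Represents B fun i => (B i).rep :=
  fun i => ⟨(B i).rep_nonzero, (Projectivization.mk_rep (B i)).symm⟩

theorem exists_represents {x : Fin n → Fin 3 → ℂ} (h : ∀ i, x i ≠ 0) : ∃ B, Represents B x :=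
  ⟨fun i => Projectivization.mk ℂ (x i) (h i), fun i => ⟨h i, rfl⟩⟩

theorem Represents.mk_mem_line {B : LineTuple n} {x : Fin n → Fin 3 → ℂ} (h : Represents B x)
    {v : Fin 3 → ℂ} (hv : v ≠ 0) (i : Fin n) :
    Projectivization.mk ℂ v hv ∈ line (B i) ↔ x i ⬝ᵥ v = 0 := by
  obtain ⟨hi, e⟩ := h i
  rw [e]
  exact Projectivization.orthogonal_mk hi hv

theorem Represents.eq_iff {B : LineTuple n} {x : Fin n → Fin 3 → ℂ} (h : Represents B x)
    (i j : Fin n) : B i = B j ↔ x i ⨯₃ x j = 0 := by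
  obtain ⟨hi, e⟩ := h i
  obtain ⟨hj, e'⟩ := h j
  rw [e, e', Projectivization.mk_eq_mk_iff_crossProduct_eq_zero]

theorem Represents.smul {B : LineTuple n} {x : Fin n → Fin 3 → ℂ} (h : Represents B x)
    {a : Fin n → ℂ} (ha : ∀ i, a i ≠ 0) : Represents B fun i => a i • x i := by
  intro i
  obtain ⟨hi, e⟩ := h i
  refine ⟨smul_ne_zero (ha i) hi, ?_⟩
  rw [e, Projectivization.mk_eq_mk_iff']
  exact ⟨(a i)⁻¹, by rw [smul_smul, inv_mul_cancel₀ (ha i), one_smul]⟩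

/-- Brackets determine which lines contain the intersection of a subfamily: this intersection lies
in the `k`-th line if `k` is a member, if two distinct members meet in a point of the `k`-th line, or
if three members have no common point. -/
theorem Represents.iInter_subset_line_iff {B : LineTuple n} {x : Fin n → Fin 3 → ℂ}
    (h : Represents B x) (hx : ∀ i j, i ≠ j → x i ⨯₃ x j ≠ 0) (I : Set (Fin n)) (k : Fin n) :
    ⋂ i ∈ I, line (B i) ⊆ line (B k) ↔
      k ∈ I ∨ (∃ i ∈ I, ∃ j ∈ I, i ≠ j ∧ bracket (x i) (x j) (x k) = 0) ∨
        ∃ i ∈ I, ∃ j ∈ I, ∃ l ∈ I, bracket (x i) (x j) (x l) ≠ 0 := by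
  constructor
  · intro hI
    by_contra! hc
    obtain ⟨hk, hij, hijl⟩ := hc
    have key : ∀ v : Fin 3 → ℂ, v ≠ 0 → (∀ i ∈ I, x i ⬝ᵥ v = 0) → x k ⬝ᵥ v = 0 := by
      intro v hv hv'
      rw [← h.mk_mem_line hv]
      exact hI (Set.mem_iInter₂.2 fun i hi => (h.mk_mem_line hv i).2 (hv' i hi))
    by_cases h2 : ∃ i ∈ I, ∃ j ∈ I, i ≠ j
    · obtain ⟨i, hi, j, hj, hne⟩ := h2
      refine hij i hi j hj hne ?_
      rw [← bracket_rotate]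
      refine key _ (hx i j hne) fun l hl => ?_
      have := hijl i hi j hj l hl
      rw [← bracket_rotate] at this
      exact this
    push Not at h2
    -- With at most one line in the family, some point on it is off the `k`-th line.
    obtain ⟨v, hv, hvk, hvI⟩ : ∃ v : Fin 3 → ℂ, v ≠ 0 ∧ x k ⬝ᵥ v ≠ 0 ∧ ∀ i ∈ I, x i ⬝ᵥ v = 0 := by
      rcases I.eq_empty_or_nonempty with rfl | ⟨i, hi⟩
      · obtain ⟨v, hv⟩ := exists_dot_eq_one (h k).1
        rw [dotProduct_comm] at hv
        refine ⟨v, ?_, ?_, by simp⟩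
        · rintro rfl; simp at hv
        · rw [hv]; exact one_ne_zero
      · have hik : i ≠ k := fun e => hk (e ▸ hi)
        obtain ⟨w, hw⟩ := exists_dot_eq_one (hx k i hik.symm)
        have e : x k ⬝ᵥ (x i ⨯₃ w) = 1 := by
          rw [← hw]
          exact (bracket_rotate _ _ _).trans ((bracket_rotate _ _ _))
        refine ⟨x i ⨯₃ w, ?_, by rw [e]; exact one_ne_zero, fun j hj => ?_⟩
        · intro h0; rw [h0] at e; simp at e
        · rw [h2 j hj i hi, dot_self_cross]
    exact hvk (key v hv hvI)
  · intro hI p hp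
    induction p using Projectivization.ind with | h v hv =>
    rw [h.mk_mem_line]
    have hp' : ∀ i ∈ I, x i ⬝ᵥ v = 0 := fun i hi =>
      (h.mk_mem_line hv i).1 (Set.mem_iInter₂.1 hp i hi)
    rcases hI with hk | ⟨i, hi, j, hj, hij, h0⟩ | ⟨i, hi, j, hj, l, hl, h0⟩
    · exact hp' k hk
    · exact dot_eq_zero_of_bracket (hx i j hij) h0 (hp' i hi) (hp' j hj)
    · exact absurd (bracket_eq_zero_of_dot hv (hp' i hi) (hp' j hj) (hp' l hl)) h0

/-- Two families that induce the same preorder on their index type have isomorphic ranges. -/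
theorem exists_orderIso_range {α β γ : Type*} [PartialOrder β] [PartialOrder γ] {f : α → β}
    {g : α → γ} (h : ∀ a b, f a ≤ f b ↔ g a ≤ g b) :
    ∃ φ : Set.range f ≃o Set.range g, ∀ a, φ ⟨f a, a, rfl⟩ = ⟨g a, a, rfl⟩ := by
  have heq : ∀ a b, f a = f b ↔ g a = g b := fun a b => by
    rw [le_antisymm_iff, h, h, ← le_antisymm_iff]
  let F : Set.range f → Set.range g := fun x => ⟨g x.2.choose, _, rfl⟩
  have hF : ∀ a, F ⟨f a, a, rfl⟩ = ⟨g a, a, rfl⟩ := fun a =>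
    Subtype.ext ((heq _ _).1 (⟨a, rfl⟩ : f a ∈ Set.range f).choose_spec)
  refine ⟨RelIso.ofSurjective (OrderEmbedding.ofMapLEIff F ?_) ?_, hF⟩
  · rintro ⟨_, a, rfl⟩ ⟨_, b, rfl⟩
    rw [hF, hF]
    exact (h a b).symm
  · rintro ⟨_, a, rfl⟩
    exact ⟨⟨f a, a, rfl⟩, hF a⟩

/-- The inclusion of an intersection of lines in a line is a statement about the partial order:
every element of the lattice below all these lines is below the given one. -/
theorem LatticeIsomorphic.iInter_subset_line_iff {A B : LineTuple n} (h : LatticeIsomorphic A B)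
    (I : Set (Fin n)) (k : Fin n) :
    ⋂ i ∈ I, line (A i) ⊆ line (A k) ↔ ⋂ i ∈ I, line (B i) ⊆ line (B k) := by
  obtain ⟨φ, hφ⟩ := h
  have key : ∀ (C : LineTuple n), ⋂ i ∈ I, line (C i) ⊆ line (C k) ↔
      ∀ X : intersectionLattice C, (∀ i ∈ I, X ≤ ⟨line (C i), line_mem_intersectionLattice C i⟩) →
        X ≤ ⟨line (C k), line_mem_intersectionLattice C k⟩ := by
    intro C
    constructor
    · intro hI X hX
      exact (Set.subset_iInter₂ hX).trans hI
    · intro hX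
      exact hX ⟨⋂ i ∈ I, line (C i), I, rfl⟩ fun i hi => Set.biInter_subset_of_mem hi
  rw [key A, key B, φ.surjective.forall]
  simp only [← hφ, φ.le_iff_le]

theorem latticeIsomorphic_of_iInter_subset_line_iff {A B : LineTuple n}
    (h : ∀ (I : Set (Fin n)) k,
      ⋂ i ∈ I, line (A i) ⊆ line (A k) ↔ ⋂ i ∈ I, line (B i) ⊆ line (B k)) :
    LatticeIsomorphic A B := by
  obtain ⟨φ, hφ⟩ := exists_orderIso_range (f := fun I : Set (Fin n) => ⋂ i ∈ I, line (A i))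
    (g := fun I : Set (Fin n) => ⋂ i ∈ I, line (B i)) (fun I J => by
      simp only [Set.subset_iInter_iff, h])
  refine ⟨φ, fun i => ?_⟩
  have := hφ {i}
  simp only [Set.mem_singleton_iff, Set.iInter_iInter_eq_left] at this
  exact this

/-- The ordered intersection lattice of an arrangement amounts to the matroid of its coefficient
vectors. -/
theorem latticeIsomorphic_iff {A B : LineTuple n} {a b : Fin n → Fin 3 → ℂ}
    (ha : Represents A a) (hb : Represents B b) (hA : IsArrangement A) :
    LatticeIsomorphic A B ↔ SameMatroid a b := by
  have hca : ∀ i j, i ≠ j → a i ⨯₃ a j ≠ 0 := fun i j hij h0 => hij (hA ((ha.eq_iff i j).2 h0))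
  constructor
  · intro h
    have hcb : ∀ i j, i ≠ j → b i ⨯₃ b j ≠ 0 := by
      intro i j hij h0
      have e : B i = B j := (hb.eq_iff i j).2 h0
      have := (h.iInter_subset_line_iff {i} j).2 (by simp [e])
      rw [ha.iInter_subset_line_iff hca] at this
      rcases this with h1 | ⟨k, hk, l, hl, hkl, -⟩ | ⟨k, hk, l, hl, m, -, hne⟩
      · exact hij h1.symm
      · exact hkl (hk.trans hl.symm)
      · rw [Set.mem_singleton_iff.1 hk, Set.mem_singleton_iff.1 hl] at hne
        exact hne (bracket_self_left _ _)
    refine ⟨fun i => (ha i).1, fun i => (hb i).1, hca, hcb, fun i j k => ?_⟩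
    by_cases hij : i = j
    · rw [hij, bracket_self_left, bracket_self_left]
    have conc : ∀ {C : LineTuple n} {c : Fin n → Fin 3 → ℂ}, Represents C c →
        (∀ i j, i ≠ j → c i ⨯₃ c j ≠ 0) →
        (bracket (c i) (c j) (c k) = 0 ↔
          ⋂ l ∈ ({i, j} : Set (Fin n)), line (C l) ⊆ line (C k)) := by
      intro C c hC hc
      have hI := hC.iInter_subset_line_iff hc {i, j} k
      rw [hI]
      constructor
      · exact fun h0 => Or.inr (Or.inl ⟨i, by simp, j, by simp, hij, h0⟩)
      · intro h0
        rw [← hI] at h0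
        rw [← bracket_rotate]
        have hne := hc i j hij
        refine (hC.mk_mem_line hne k).1 (h0 (Set.mem_iInter₂.2 fun l hl => ?_))
        rw [hC.mk_mem_line]
        rcases hl with rfl | rfl
        exacts [dot_self_cross _ _, dot_cross_self _ _]
    rw [conc ha hca, conc hb hcb]
    exact h.iInter_subset_line_iff _ _
  · intro h
    refine latticeIsomorphic_of_iInter_subset_line_iff fun I k => ?_
    rw [ha.iInter_subset_line_iff h.cross_left, hb.iInter_subset_line_iff h.cross_right]
    simp only [ne_eq, h.bracket_iff]

/-- If `M` acts on coefficient vectors, the inverse transpose of `M` acts on points. -/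
theorem projectivelyEquivalent_of_mulVec {B C : LineTuple n} {x : Fin n → Fin 3 → ℂ}
    {M : Matrix (Fin 3) (Fin 3) ℂ} (hM : M.det ≠ 0) (hB : Represents B x)
    (hC : Represents C fun i => M *ᵥ x i) : ProjectivelyEquivalent B C := by
  have hM' : IsUnit Mᵀ.det := by rw [Matrix.det_transpose]; exact isUnit_iff_ne_zero.2 hM
  let g : GL (Fin 3) ℂ := (Matrix.GeneralLinearGroup.mk'' Mᵀ hM')⁻¹
  refine ⟨Matrix.ProjGenLinGroup.mk g, fun i => ?_⟩
  have key : ∀ p : Plane, Matrix.ProjGenLinGroup.mk g • p ∈ line (C i) ↔ p ∈ line (B i) := by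
    intro p
    induction p using Projectivization.ind with | h v hv =>
    rw [Projectivization.PGL.mk_smul_mk, hC.mk_mem_line, hB.mk_mem_line]
    have : (M *ᵥ x i) ⬝ᵥ (g • v) = x i ⬝ᵥ v := by
      change (M *ᵥ x i) ⬝ᵥ ((Mᵀ)⁻¹ *ᵥ v) = _
      rw [dotProduct_comm, Matrix.dotProduct_mulVec, ← Matrix.mulVec_transpose,
        Matrix.mulVec_mulVec, Matrix.mul_nonsing_inv _ hM', Matrix.one_mulVec, dotProduct_comm]
    rw [this]
  ext p
  constructor
  · rintro ⟨q, hq, rfl⟩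
    exact (key q).2 hq
  · intro hp
    refine ⟨(Matrix.ProjGenLinGroup.mk g)⁻¹ • p, ?_, by simp⟩
    rw [← key]
    simpa using hp

/-! ### Generic points of a linear motion -/

theorem IsMultihomogeneous.eval_smul {f : MvPolynomial (Fin n × Fin 3) ℂ} {d : Fin n → ℕ}
    (hf : IsMultihomogeneous f d) (a : Fin n → ℂ) (x : Fin n → Fin 3 → ℂ) :
    MvPolynomial.eval (fun p : Fin n × Fin 3 => a p.1 * x p.1 p.2) f =
      (∏ i, a i ^ d i) * MvPolynomial.eval (fun p : Fin n × Fin 3 => x p.1 p.2) f := by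
  rw [MvPolynomial.eval_eq', MvPolynomial.eval_eq', Finset.mul_sum]
  refine Finset.sum_congr rfl fun m hm => ?_
  have hw := hf (MvPolynomial.mem_support_iff.1 hm)
  have hd : ∀ i, d i = ∑ j, m (i, j) := by
    intro i
    rw [← hw, Finsupp.weight_apply, Finsupp.sum_fintype _ _ (by simp), Finset.sum_apply,
      Fintype.sum_prod_type]
    simp [Pi.single_apply]
  simp only [mul_pow, Finset.prod_mul_distrib]
  have : ∏ p : Fin n × Fin 3, a p.1 ^ m p = ∏ i, a i ^ d i := by
    rw [Fintype.prod_prod_type]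
    exact Finset.prod_congr rfl fun i _ => by
      rw [hd, ← Finset.prod_pow_eq_pow_sum]
  rw [this]
  ring

theorem Represents.mem_nonvanishing_iff {B : LineTuple n} {x : Fin n → Fin 3 → ℂ}
    (h : Represents B x) {f : MvPolynomial (Fin n × Fin 3) ℂ} {d : Fin n → ℕ}
    (hf : IsMultihomogeneous f d) :
    B ∈ nonvanishing f ↔ MvPolynomial.eval (fun p : Fin n × Fin 3 => x p.1 p.2) f ≠ 0 := by
  have hrep : ∀ i, ∃ a : ℂ, a ≠ 0 ∧ (B i).rep = a • x i := by
    intro i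
    obtain ⟨hi, e⟩ := h i
    obtain ⟨a, ha⟩ := Projectivization.exists_smul_eq_mk_rep ℂ (x i) hi
    exact ⟨a, a.ne_zero, by rw [e, ← ha]; rfl⟩
  choose a ha hrep using hrep
  change MvPolynomial.eval (fun p : Fin n × Fin 3 => (B p.1).rep p.2) f ≠ 0 ↔ _
  simp only [hrep, Pi.smul_apply, smul_eq_mul]
  rw [hf.eval_smul, mul_ne_zero_iff_left]
  exact Finset.prod_ne_zero_iff.2 fun i _ => pow_ne_zero _ (ha i)

/-- A polynomial that is nonzero at one time of a linear motion is nonzero at all but finitely many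
times. -/
theorem eventually_eval_interpolate_ne_zero (f : MvPolynomial (ι × Fin 3) ℂ)
    (x y : ι → Fin 3 → ℂ) {t₀ : ℂ}
    (h : MvPolynomial.eval (fun p : ι × Fin 3 => interpolate t₀ (x p.1) (y p.1) p.2) f ≠ 0) :
    ∀ᶠ t in cofinite,
      MvPolynomial.eval (fun p : ι × Fin 3 => interpolate t (x p.1) (y p.1) p.2) f ≠ 0 := by
  let P : Polynomial ℂ := MvPolynomial.eval₂ Polynomial.C (fun p : ι × Fin 3 =>
    (1 - Polynomial.X) * Polynomial.C (x p.1 p.2) + Polynomial.X * Polynomial.C (y p.1 p.2)) f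
  have hP : ∀ t, P.eval t =
      MvPolynomial.eval (fun p : ι × Fin 3 => interpolate t (x p.1) (y p.1) p.2) f := by
    intro t
    rw [← Polynomial.coe_evalRingHom, MvPolynomial.eval₂_comp_left, MvPolynomial.eval]
    congr 1
    · ext; simp
    · funext p; simp [interpolate_apply, mul_comm t]
  have hP0 : P ≠ 0 := by
    intro h0
    rw [← hP, h0, Polynomial.eval_zero] at h
    exact h rfl
  have := Polynomial.finite_setOfPred_isRoot hP0
  filter_upwards [this.compl_mem_cofinite] with t ht
  rw [← hP]
  exact ht

/-- A linear motion that meets a Zariski open set stays in it for all but finitely many times. -/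
theorem eventually_mem_of_isOpen {U : Set (LineTuple n)} (hU : IsOpen U)
    {x y : Fin n → Fin 3 → ℂ} {t₀ : ℂ} {B : LineTuple n}
    (hB : Represents B fun i => interpolate t₀ (x i) (y i)) (hBU : B ∈ U) :
    ∀ᶠ t in cofinite, ∀ D, Represents D (fun i => interpolate t (x i) (y i)) → D ∈ U := by
  induction hU with
  | basic V hV =>
    obtain ⟨f, d, hf, rfl⟩ := hV
    filter_upwards [eventually_eval_interpolate_ne_zero f x y ((hB.mem_nonvanishing_iff hf).1 hBU)]
      with t ht D hD
    exact (hD.mem_nonvanishing_iff hf).2 ht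
  | univ => simp
  | inter V W _ _ hV hW =>
    filter_upwards [hV hBU.1, hW hBU.2] with t h₁ h₂ D hD
    exact ⟨h₁ D hD, h₂ D hD⟩
  | sUnion S _ ih =>
    obtain ⟨V, hV, hBV⟩ := hBU
    filter_upwards [ih V hV hBV] with t ht D hD
    exact ⟨V, hV, ht D hD⟩

theorem eventually_bracket_interpolate_ne_zero {u v w : Fin 3 → ℂ} (u' v' w' : Fin 3 → ℂ)
    (h : bracket u v w ≠ 0) :
    ∀ᶠ t in cofinite,
      bracket (interpolate t u u') (interpolate t v v') (interpolate t w w') ≠ 0 := by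
  let X : Fin 3 → Fin 3 → MvPolynomial (Fin 3 × Fin 3) ℂ := fun i j => MvPolynomial.X (i, j)
  have hf : ∀ t, MvPolynomial.eval
      (fun p : Fin 3 × Fin 3 => interpolate t (![u, v, w] p.1) (![u', v', w'] p.1) p.2)
      (X 0 0 * (X 1 1 * X 2 2 - X 1 2 * X 2 1) + X 0 1 * (X 1 2 * X 2 0 - X 1 0 * X 2 2) +
        X 0 2 * (X 1 0 * X 2 1 - X 1 1 * X 2 0)) =
      bracket (interpolate t u u') (interpolate t v v') (interpolate t w w') := by
    intro t
    simp [X, bracket_eq]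
  simp only [← hf]
  refine eventually_eval_interpolate_ne_zero _ _ _ (t₀ := 0) ?_
  rw [hf, interpolate_zero, interpolate_zero, interpolate_zero]
  exact h

/-- If a linear motion keeps the vanishing brackets, the other ones vanish only finitely often. -/
theorem eventually_sameMatroid [Finite ι] {a x y : ι → Fin 3 → ℂ} (h : SameMatroid a x)
    (hxy : ∀ i j k, bracket (a i) (a j) (a k) = 0 → ∀ t,
      bracket (interpolate t (x i) (y i)) (interpolate t (x j) (y j))
        (interpolate t (x k) (y k)) = 0) :
    ∀ᶠ t in cofinite, SameMatroid a fun i => interpolate t (x i) (y i) := by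
  have h₁ : ∀ᶠ t in cofinite, ∀ i, interpolate t (x i) (y i) ≠ 0 := by
    refine eventually_all.2 fun i => ?_
    obtain ⟨l, hl⟩ := Function.ne_iff.1 (h.ne_zero_right i)
    filter_upwards [eventually_eval_interpolate_ne_zero (MvPolynomial.X (i, l)) x y (t₀ := 0)
      (by rw [MvPolynomial.eval_X, interpolate_zero]; exact hl)] with t ht h0
    rw [MvPolynomial.eval_X, h0] at ht
    exact ht rfl
  have h₂ : ∀ᶠ t in cofinite, ∀ i j, i ≠ j →
      interpolate t (x i) (y i) ⨯₃ interpolate t (x j) (y j) ≠ 0 := by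
    refine eventually_all.2 fun i => eventually_all.2 fun j => ?_
    by_cases hij : i = j
    · exact Eventually.of_forall fun t h => absurd hij h
    obtain ⟨w, hw⟩ := exists_dot_eq_one (h.cross_right i j hij)
    have hb : bracket w (x i) (x j) ≠ 0 := hw.trans_ne one_ne_zero
    filter_upwards [eventually_bracket_interpolate_ne_zero w (y i) (y j) hb] with t ht _ h0
    exact ht (by rw [bracket, h0, dotProduct_zero])
  have h₃ : ∀ᶠ t in cofinite, ∀ i j k, bracket (a i) (a j) (a k) ≠ 0 →
      bracket (interpolate t (x i) (y i)) (interpolate t (x j) (y j)) (interpolate t (x k) (y k)) ≠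
        0 := by
    refine eventually_all.2 fun i => eventually_all.2 fun j => eventually_all.2 fun k => ?_
    by_cases h0 : bracket (a i) (a j) (a k) = 0
    · exact Eventually.of_forall fun t hne => absurd h0 hne
    · filter_upwards [eventually_bracket_interpolate_ne_zero (y i) (y j) (y k)
        (fun h' => h0 ((h.bracket_iff i j k).2 h'))] with t ht _
      exact ht
  filter_upwards [h₁, h₂, h₃] with t h₁ h₂ h₃
  exact ⟨h.ne_zero_left, h₁, h.cross_left, h₂,
    fun i j k => ⟨fun h0 => hxy i j k h0 t, fun h0 => by_contra fun hne => h₃ i j k hne h0⟩⟩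

/-- The moduli space is irreducible if any two realizations are joined, up to projective equivalence,
by a linear motion through realizations, finitely many times excepted. -/
theorem irreducibleSpace_moduliSpace {A : LineTuple n}
    (h : ∀ B C, LatticeIsomorphic A B → LatticeIsomorphic A C → ∃ B' C' x y,
      ProjectivelyEquivalent B B' ∧ ProjectivelyEquivalent C C' ∧
      LatticeIsomorphic A B' ∧ LatticeIsomorphic A C' ∧ Represents B' x ∧ Represents C' y ∧
      ∀ᶠ t in cofinite, ∃ D, LatticeIsomorphic A D ∧
        Represents D fun i => interpolate t (x i) (y i)) :
    IrreducibleSpace (ModuliSpace A) := by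
  have hA : LatticeIsomorphic A A := ⟨OrderIso.refl _, fun _ => rfl⟩
  have : Nonempty (ModuliSpace A) := ⟨Quotient.mk (projectiveSetoid A) ⟨A, hA⟩⟩
  let π : RealizationSpace A → ModuliSpace A := Quotient.mk (projectiveSetoid A)
  have hπ : Continuous π := continuous_quot_mk
  refine { toPreirreducibleSpace := ⟨?_⟩, toNonempty := this }
  rintro U V hU hV ⟨b, -, hb⟩ ⟨c, -, hc⟩
  obtain ⟨B, rfl⟩ : ∃ B, π B = b := Quotient.exists_rep b
  obtain ⟨C, rfl⟩ : ∃ C, π C = c := Quotient.exists_rep c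
  obtain ⟨B', C', x, y, hBB', hCC', hAB', hAC', hx, hy, hD⟩ := h B.1 C.1 B.2 C.2
  have eB : π B = π ⟨B', hAB'⟩ := Quotient.sound hBB'
  have eC : π C = π ⟨C', hAC'⟩ := Quotient.sound hCC'
  rw [eB] at hb
  rw [eC] at hc
  obtain ⟨U', hU', eU⟩ := isOpen_induced_iff.1 (hU.preimage hπ)
  obtain ⟨V', hV', eV⟩ := isOpen_induced_iff.1 (hV.preimage hπ)
  have hBU : B' ∈ U' := (Set.ext_iff.1 eU ⟨B', hAB'⟩).2 hb
  have hCV : C' ∈ V' := (Set.ext_iff.1 eV ⟨C', hAC'⟩).2 hc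
  obtain ⟨t, ⟨D, hAD, hDt⟩, hU, hV⟩ := (hD.and
    ((eventually_mem_of_isOpen hU' (t₀ := 0) (x := x) (y := y)
      (by simpa only [interpolate_zero] using! hx) hBU).and
    (eventually_mem_of_isOpen hV' (t₀ := 1) (x := x) (y := y)
      (by simpa only [interpolate_one] using! hy) hCV))).exists
  exact ⟨π ⟨D, hAD⟩, trivial, (Set.ext_iff.1 eU ⟨D, hAD⟩).1 (hU D hDt),
    (Set.ext_iff.1 eV ⟨D, hAD⟩).1 (hV D hDt)⟩

/-- The moduli space of an arrangement is irreducible if at least two and all but at most four of its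
lines pass through one point. -/
theorem irreducibleSpace_moduliSpace_of_card_le {A : LineTuple n} (hA : IsArrangement A)
    {T : Finset (Fin n)} (hT : T.card ≤ 4) {P : Plane} (hP : ∀ i, P ∈ line (A i) ↔ i ∉ T)
    {i j : Fin n} (hi : i ∉ T) (hj : j ∉ T) (hij : i ≠ j) :
    IrreducibleSpace (ModuliSpace A) := by
  have ha := represents_rep A
  obtain ⟨a, haa⟩ : ∃ a, a = fun i => (A i).rep := ⟨_, rfl⟩
  rw [← haa] at ha
  have haT : ∀ k, bracket (a i) (a j) (a k) = 0 ↔ k ∉ T := by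
    intro k
    induction P using Projectivization.ind with | h v hv =>
    simp only [ha.mk_mem_line] at hP
    rw [← hP]
    have hne : a i ⨯₃ a j ≠ 0 := fun h => hij (hA ((ha.eq_iff i j).2 h))
    exact ⟨fun h => dot_eq_zero_of_bracket hne h ((hP i).2 hi) ((hP j).2 hj),
      fun h => bracket_eq_zero_of_dot hv ((hP i).2 hi) ((hP j).2 hj) h⟩
  refine irreducibleSpace_moduliSpace fun B C hAB hAC => ?_
  have hb := represents_rep B
  have hc := represents_rep C
  obtain ⟨b, hbb⟩ : ∃ b, b = fun i => (B i).rep := ⟨_, rfl⟩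
  obtain ⟨c, hcc⟩ : ∃ c, c = fun i => (C i).rep := ⟨_, rfl⟩
  rw [← hbb] at hb
  rw [← hcc] at hc
  have hab := (latticeIsomorphic_iff ha hb hA).1 hAB
  have hac := (latticeIsomorphic_iff ha hc hA).1 hAC
  have pencil : ∀ {x : Fin n → Fin 3 → ℂ}, SameMatroid a x → ∀ k,
      x k ⬝ᵥ (x i ⨯₃ x j) = 0 ↔ k ∉ T := fun {x} hx k => by
    rw [← haT, hx.bracket_iff, ← bracket_rotate, bracket]
  obtain ⟨M, hM, r, s, hr, hs, H⟩ := exists_interpolation_of_card_le_four hT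
    (hab.cross_right i j hij) (hac.cross_right i j hij) (hab.symm_trans hac) (pencil hab)
    (pencil hac) hi hj hij
  have hMb := hab.symm.mulVec hM
  have hax : SameMatroid a fun i => r i • M *ᵥ b i := by
    simpa only [one_smul] using! (hMb.smul hr (b := fun _ => 1) fun _ => one_ne_zero).symm
  obtain ⟨B', hB'⟩ := exists_represents hMb.ne_zero_left
  have hrB' := hB'.smul hr
  refine ⟨B', C, fun i => r i • M *ᵥ b i, fun i => s i • c i,
    projectivelyEquivalent_of_mulVec hM hb hB', (projectivelyEquivalent_equivalence n).refl C,
    (latticeIsomorphic_iff ha hrB' hA).2 hax, hAC, hrB', hc.smul hs, ?_⟩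
  filter_upwards [eventually_sameMatroid hax fun i j k h0 t =>
    H i j k ((hab.bracket_iff i j k).1 h0) t] with t ht
  obtain ⟨D, hD⟩ := exists_represents ht.ne_zero_right
  exact ⟨D, (latticeIsomorphic_iff ha hD hA).2 ht, hD⟩

end LineArrangement

theorem mainTheorem7 (A : LineArrangement.LineTuple 9) (hA : LineArrangement.IsArrangement A)
    (hP : ∃ P : LineArrangement.Plane, 5 ≤ LineArrangement.multiplicity A P) :
    IrreducibleSpace (LineArrangement.ModuliSpace A) := by
  classical
  obtain ⟨P, hP⟩ := hP
  let T : Finset (Fin 9) := Finset.univ.filter fun i => P ∉ LineArrangement.line (A i)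
  have hS : 5 ≤ Tᶜ.card := by
    rw [LineArrangement.multiplicity, Set.ncard_eq_toFinset_card'] at hP
    refine hP.trans_eq (congrArg _ ?_)
    ext i
    simp [T]
  have hcard := Finset.card_compl_add_card T
  rw [Fintype.card_fin] at hcard
  obtain ⟨i, hi, j, hj, hij⟩ := Finset.one_lt_card.1 (by omega : 1 < Tᶜ.card)
  exact LineArrangement.irreducibleSpace_moduliSpace_of_card_le hA (by omega : T.card ≤ 4)
    (P := P) (fun i => by simp [T]) (Finset.mem_compl.1 hi) (Finset.mem_compl.1 hj) hij
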